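/- Let $k\ge 1$ and $\nu>1$ be integers, let $\chi$ be a Dirichlet character modulo $k$ (not necessarily primitive or real) with $\chi(-1)=(-1)^{\nu}$, and put $A=\tfrac12 L(1-\nu,\chi)$, where $L(s,\chi)$ is the analytic continuation of $\sum_{n\ge1}\chi(n)n^{-s}$. For $\operatorname{Im}z>0$ and $q=e^{2\pi i z}$ let $$v_0(z)=q^{-A}\prod_{n=1}^{\infty}(1-q^n)^{\chi(n)n^{\nu-2}},$$ where $q^{-A}=e^{-2\pi i A z}$ and the powers of $1-q^n$ are principal. Then the product converges, $v_0$ is holomorphic without zeros on the upper half plane, and its logarithmic derivative is $$v(z)=\frac{d}{dz}\log v_0(z)=-2\pi i A+\pi\sum_{n=1}^{\infty}\frac{\chi(n)n^{\nu-1}e^{i\pi n z}}{\sin(n\pi z)},$$ the series converging absolutely. Moreover, unless $k=1$ and $\nu=2$, $v$ is a modular form of weight $\nu$ in $M_\nu(\Gamma_0(k),\chi)$, and in particular in $M_\nu(\Gamma(k),\chi)$. Here, for a subgroup $\Gamma\subseteq\Gamma_0(k)$ of finite index, $M_\nu(\Gamma,\chi)$ is the space of functions $f$ that are holomorphic on the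 upper half plane and at all cusps of $\Gamma$ and satisfy $f\left(\frac{az+b}{cz+d}\right)=\chi(d)(cz+d)^{\nu}f(z)$ for all $\begin{pmatrix}a&b\\c&d\end{pmatrix}\in\Gamma$. -/

import Mathlib

open scoped MatrixGroups ModularForm Manifold UpperHalfPlane

/-- Modular forms of weight `k` and character `χ` (a Dirichlet character mod `N`) on a
subgroup `Γ` of `SL(2, ℤ)`, i.e. the elements of `M_k(Γ, χ)`: functions `f` on the upper half plane
with `f ((a z + b) / (c z + d)) = χ(d) (c z + d) ^ k f z` for all `(a, b; c, d) ∈ Γ`, which are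
holomorphic on the upper half plane and at every cusp of `Γ`. For `χ = 1` this is Mathlib's
`ModularForm`. -/
structure IsModularFormWithChar (Γ : Subgroup SL(2, ℤ)) (k : ℤ) {N : ℕ}
    (χ : DirichletCharacter ℂ N) (f : ℍ → ℂ) : Prop where
  slash_eq : ∀ γ ∈ Γ, f ∣[k] γ = χ ((γ 1 1 : ℤ) : ZMod N) • f
  holo : MDiff f
  bdd_at_cusps : ∀ c : OnePoint ℝ,
    IsCusp c (Γ.map (Matrix.SpecialLinearGroup.mapGL ℝ)) → c.IsBoundedAt f k

namespace BorcherdsProduct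

/-- The nome `q = e(z) = exp(2 π i z)`. -/
noncomputable def nome (z : ℂ) : ℂ := Complex.exp (2 * Real.pi * Complex.I * z)

/-- The constant `A = L(χ, 1 - ν) / 2`, where `L` is the analytically continued `L`-function. -/
noncomputable def constA {k : ℕ} [NeZero k] (χ : DirichletCharacter ℂ k) (ν : ℕ) : ℂ :=
  DirichletCharacter.LFunction χ (1 - (ν : ℂ)) / 2

/-- The factor `(1 - q ^ n) ^ (χ(n) n ^ (ν - 2))` of the product (for `ν ≥ 2`), as a principal
power; note that `1 - q ^ n` has positive real part for `Im z > 0`, `n ≥ 1`. -/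
noncomputable def factor {k : ℕ} (χ : DirichletCharacter ℂ k) (ν : ℕ) (z : ℂ) (n : ℕ) : ℂ :=
  (1 - nome z ^ n) ^ (χ (n : ZMod k) * (n : ℂ) ^ (ν - 2))

/-- The product `v₀(z) = q ^ (-A) ∏_{n ≥ 1} (1 - q ^ n) ^ (χ(n) n ^ (ν - 2))`, where
`q ^ (-A)` means `exp(-2 π i A z)`. -/
noncomputable def product {k : ℕ} [NeZero k] (χ : DirichletCharacter ℂ k) (ν : ℕ) (z : ℂ) : ℂ :=
  Complex.exp (-(2 * Real.pi * Complex.I * constA χ ν * z)) * ∏' n : ℕ, factor χ ν z (n + 1)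

/-- The term `χ(n) n ^ (ν - 1) e ^ (i n π z) / sin (n π z)`. -/
noncomputable def term {k : ℕ} (χ : DirichletCharacter ℂ k) (ν : ℕ) (z : ℂ) (n : ℕ) : ℂ :=
  χ (n : ZMod k) * (n : ℂ) ^ (ν - 1) * Complex.exp (Complex.I * n * Real.pi * z) / Complex.sin (n * Real.pi * z)

end BorcherdsProduct

/-! ### Convergence of the product and its logarithmic derivative. -/

namespace BorcherdsProduct

open Complex Filter Topology

/-! On each half plane `Im z > y > 0` the logarithms of the factors are dominated by a multiple of
`n ^ (ν - 2) r ^ n` with `r < 1`, so the product converges, has no zeros, and may be differentiated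
termwise. This gives `v = -2πi (A + ∑ χ(n) n ^ (ν - 1) q ^ n / (1 - q ^ n))`.

The bracket is an Eisenstein series: up to a constant it is `∑_m ∑_n 𝓕χ(n) (k m z + n) ^ (-ν)`
(`latticeSum_eq`). The rows `m ≠ 0` give the Lambert series by Lipschitz' formula, and the row `m =
0` gives `A` by the functional equation (`constA_eq`). The parity of `χ` makes the contributions of
`m` and `-m` agree. For `ν ≥ 3` the double series converges absolutely, and modularity under `Γ₀(k)`
is a change of summation variables. For `ν = 2` and `k ≠ 1`, `∑ 𝓕χ = 0` turns it into a combination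
of values `℘(j / k)`, which transform correctly (`latticeSum_mobius_two`).

At the cusps, `v` is bounded by a power of `1 + 1 / Im z`, so each `v ∣ γ` grows at most
polynomially in `Im z`. Being periodic, it is bounded by Riemann's removable singularity theorem
(`isBoundedAtImInfty_slash`). -/

lemma norm_nome (z : ℂ) : ‖nome z‖ = Real.exp (-(2 * Real.pi * z.im)) := by
  rw [nome, Complex.norm_exp]
  congr 1
  simp

lemma norm_nome_lt_one {z : ℂ} (hz : 0 < z.im) : ‖nome z‖ < 1 := by
  rw [norm_nome, Real.exp_lt_one_iff]
  have := Real.pi_pos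
  have : 0 < 2 * Real.pi * z.im := by positivity
  linarith

lemma norm_nome_le {z : ℂ} {y : ℝ} (h : y ≤ z.im) :
    ‖nome z‖ ≤ Real.exp (-(2 * Real.pi * y)) := by
  rw [norm_nome]
  have := Real.pi_pos
  gcongr

lemma hasDerivAt_nome_pow (z : ℂ) (n : ℕ) :
    HasDerivAt (fun w ↦ nome w ^ n) (2 * Real.pi * I * n * nome z ^ n) z := by
  have h (w : ℂ) : nome w ^ n = cexp (2 * Real.pi * I * n * w) := by
    rw [nome, ← Complex.exp_nat_mul]; ring_nf
  simp_rw [h]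
  have := ((hasDerivAt_id z).const_mul (2 * Real.pi * I * n)).cexp
  simpa [mul_comm] using this

lemma norm_nome_pow_lt_one {z : ℂ} (hz : 0 < z.im) {n : ℕ} (hn : n ≠ 0) : ‖nome z ^ n‖ < 1 := by
  rw [norm_pow]
  exact pow_lt_one₀ (norm_nonneg _) (norm_nome_lt_one hz) hn

lemma one_sub_ne_zero_of_norm_lt_one {w : ℂ} (hw : ‖w‖ < 1) : 1 - w ≠ 0 := by
  intro h
  rw [← sub_eq_zero.mp h] at hw
  simp at hw

lemma norm_log_one_sub_le {w : ℂ} {r : ℝ} (hw : ‖w‖ ≤ r) (hr : r < 1) :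
    ‖Complex.log (1 - w)‖ ≤ (1 + (1 - r)⁻¹) * ‖w‖ := by
  have h1 : ‖-w‖ < 1 := by rw [norm_neg]; linarith
  have h := Complex.norm_log_one_add_le h1
  rw [norm_neg, ← sub_eq_add_neg] at h
  have h0 := norm_nonneg w
  have h2 : (1 - ‖w‖)⁻¹ ≤ (1 - r)⁻¹ := by
    apply inv_anti₀ <;> linarith
  have h3 : 0 ≤ (1 - ‖w‖)⁻¹ := by
    apply inv_nonneg.mpr; linarith
  have h4 : ‖w‖ ^ 2 * (1 - ‖w‖)⁻¹ / 2 ≤ ‖w‖ * (1 - r)⁻¹ := by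
    have : ‖w‖ ^ 2 ≤ ‖w‖ := by nlinarith
    calc ‖w‖ ^ 2 * (1 - ‖w‖)⁻¹ / 2 ≤ ‖w‖ ^ 2 * (1 - ‖w‖)⁻¹ := by
          have : 0 ≤ ‖w‖ ^ 2 * (1 - ‖w‖)⁻¹ := by positivity
          linarith
      _ ≤ ‖w‖ * (1 - r)⁻¹ := by gcongr
  linarith

/-- The logarithm of `factor`. -/
noncomputable def logFactor {k : ℕ} (χ : DirichletCharacter ℂ k) (ν : ℕ) (n : ℕ) (z : ℂ) : ℂ :=
  χ (n : ZMod k) * (n : ℂ) ^ (ν - 2) * Complex.log (1 - nome z ^ n)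

variable {k : ℕ} (χ : DirichletCharacter ℂ k) (ν : ℕ)

lemma cexp_logFactor {z : ℂ} (hz : 0 < z.im) {n : ℕ} (hn : n ≠ 0) :
    cexp (logFactor χ ν n z) = factor χ ν z n := by
  rw [factor, Complex.cpow_def_of_ne_zero
    (one_sub_ne_zero_of_norm_lt_one (norm_nome_pow_lt_one hz hn)), logFactor, mul_comm]

lemma hasDerivAt_logFactor {z : ℂ} (hz : 0 < z.im) {n : ℕ} (hn : n ≠ 0) :
    HasDerivAt (logFactor χ ν n) (χ (n : ZMod k) * (n : ℂ) ^ (ν - 2) *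
      (-(2 * Real.pi * I * n * nome z ^ n) / (1 - nome z ^ n))) z := by
  refine HasDerivAt.const_mul _ (HasDerivAt.clog ?_ ?_)
  · simpa using (hasDerivAt_nome_pow z n).const_sub 1
  · refine Complex.mem_slitPlane_of_norm_lt_one (z := -(nome z ^ n)) ?_
    rw [norm_neg]
    exact norm_nome_pow_lt_one hz hn

lemma differentiableOn_logFactor {n : ℕ} (hn : n ≠ 0) :
    DifferentiableOn ℂ (logFactor χ ν n) {z | 0 < z.im} := fun _ hz ↦
  (hasDerivAt_logFactor χ ν hz hn).differentiableAt.differentiableWithinAt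

/-- A majorant uniform on a half plane, as both holomorphy of the sum and termwise differentiation
require. It exists because `|q| ≤ exp (-2πy) < 1` there. -/
lemma exists_summable_norm_logFactor_le {y : ℝ} (hy : 0 < y) :
    ∃ u : ℕ → ℝ, Summable u ∧ ∀ n (z : ℂ), y < z.im → ‖logFactor χ ν (n + 1) z‖ ≤ u n := by
  set r := Real.exp (-(2 * Real.pi * y)) with hr
  have hr0 : 0 ≤ r := (Real.exp_pos _).le
  have hr1 : r < 1 := by
    rw [hr, Real.exp_lt_one_iff]
    have := Real.pi_pos
    have : 0 < 2 * Real.pi * y := by positivity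
    linarith
  have hs : Summable fun n : ℕ ↦ (n : ℝ) ^ (ν - 2) * r ^ n :=
    summable_pow_mul_geometric_of_norm_lt_one _ (by rwa [Real.norm_of_nonneg hr0])
  refine ⟨fun n ↦ (1 + (1 - r)⁻¹) * (((n + 1 : ℕ) : ℝ) ^ (ν - 2) * r ^ (n + 1)),
    ((summable_nat_add_iff 1).mpr hs).mul_left _, fun n z hz ↦ ?_⟩
  have h1 : ‖nome z ^ (n + 1)‖ ≤ r ^ (n + 1) := by
    rw [norm_pow]
    exact pow_le_pow_left₀ (norm_nonneg _) (norm_nome_le hz.le) _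
  have h2 : ‖nome z ^ (n + 1)‖ ≤ r :=
    h1.trans (pow_le_of_le_one hr0 hr1.le (Nat.succ_ne_zero n))
  have h3 := norm_log_one_sub_le h2 hr1
  have h4 : 0 ≤ 1 + (1 - r)⁻¹ := by
    have : 0 ≤ (1 - r)⁻¹ := inv_nonneg.mpr (by linarith)
    linarith
  rw [logFactor, norm_mul, norm_mul, norm_pow, Complex.norm_natCast]
  calc _ ≤ 1 * ((n + 1 : ℕ) : ℝ) ^ (ν - 2) * ((1 + (1 - r)⁻¹) * r ^ (n + 1)) := by
        gcongr
        · exact DirichletCharacter.norm_le_one χ _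
        · exact h3.trans (by gcongr)
    _ = _ := by ring

lemma isOpen_lt_im (y : ℝ) : IsOpen {z : ℂ | y < z.im} :=
  isOpen_lt continuous_const Complex.continuous_im

lemma summable_logFactor {z : ℂ} (hz : 0 < z.im) :
    Summable fun n ↦ logFactor χ ν (n + 1) z := by
  obtain ⟨u, hu, h⟩ := exists_summable_norm_logFactor_le χ ν (half_pos hz)
  exact Summable.of_norm_bounded hu fun n ↦ h n z (half_lt_self hz)

lemma multipliable_factor {z : ℂ} (hz : 0 < z.im) :
    Multipliable fun n : ℕ ↦ factor χ ν z (n + 1) := by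
  have := (summable_logFactor χ ν hz).hasSum.cexp.multipliable
  exact this.congr fun n ↦ cexp_logFactor χ ν hz n.succ_ne_zero

lemma tprod_factor {z : ℂ} (hz : 0 < z.im) :
    ∏' n : ℕ, factor χ ν z (n + 1) = cexp (∑' n, logFactor χ ν (n + 1) z) := by
  rw [← (summable_logFactor χ ν hz).hasSum.cexp.tprod_eq]
  exact tprod_congr fun n ↦ (cexp_logFactor χ ν hz n.succ_ne_zero).symm

lemma differentiableOn_tsum_logFactor :
    DifferentiableOn ℂ (fun z ↦ ∑' n, logFactor χ ν (n + 1) z) {z | 0 < z.im} := by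
  intro z hz
  obtain ⟨u, hu, h⟩ := exists_summable_norm_logFactor_le χ ν (half_pos (show 0 < z.im from hz))
  have := differentiableOn_tsum_of_summable_norm hu
    (fun n ↦ (differentiableOn_logFactor χ ν n.succ_ne_zero).mono
      (fun w (hw : z.im / 2 < w.im) ↦ (half_pos (show 0 < z.im from hz)).trans hw))
    (isOpen_lt_im (z.im / 2)) (fun n w hw ↦ h n w hw)
  exact (this.differentiableAt ((isOpen_lt_im _).mem_nhds
    (half_lt_self (show 0 < z.im from hz)))).differentiableWithinAt

lemma hasSum_deriv_logFactor {z : ℂ} (hz : 0 < z.im) :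
    HasSum (fun n ↦ deriv (logFactor χ ν (n + 1)) z)
      (deriv (fun w ↦ ∑' n, logFactor χ ν (n + 1) w) z) := by
  obtain ⟨u, hu, h⟩ := exists_summable_norm_logFactor_le χ ν (half_pos hz)
  exact hasSum_deriv_of_summable_norm hu
    (fun n ↦ (differentiableOn_logFactor χ ν n.succ_ne_zero).mono
      (fun w (hw : z.im / 2 < w.im) ↦ (half_pos hz).trans hw))
    (isOpen_lt_im (z.im / 2)) (fun n w hw ↦ h n w hw) (half_lt_self hz)

lemma term_eq (z : ℂ) (n : ℕ) :
    term χ ν z n = -2 * I * (χ (n : ZMod k) * (n : ℂ) ^ (ν - 1) *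
      (nome z ^ n / (1 - nome z ^ n))) := by
  set w := cexp (I * n * Real.pi * z) with hw
  have hw0 : w ≠ 0 := Complex.exp_ne_zero _
  have h1 : nome z ^ n = w ^ 2 := by
    rw [nome, hw, ← Complex.exp_nat_mul, ← Complex.exp_nat_mul]; congr 1; push_cast; ring
  have h2 : Complex.sin (n * Real.pi * z) = (w⁻¹ - w) * I / 2 := by
    rw [Complex.sin, hw, ← Complex.exp_neg]; ring_nf
  rw [term, ← hw, h1, h2]
  -- When the sine vanishes both sides are divisions by zero, so no condition on `z` is needed.
  rcases eq_or_ne (1 - w ^ 2) 0 with h | h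
  · have : w⁻¹ - w = 0 := by
      have : w⁻¹ - w = w⁻¹ * (1 - w ^ 2) := by field_simp
      rw [this, h, mul_zero]
    simp [h, this]
  · have : (w⁻¹ - w) = w⁻¹ * (1 - w ^ 2) := by field_simp
    rw [this]
    field_simp
    rw [I_sq]
    ring

lemma deriv_logFactor_eq (hν : 1 < ν) {z : ℂ} (hz : 0 < z.im) {n : ℕ} (hn : n ≠ 0) :
    deriv (logFactor χ ν n) z = Real.pi * term χ ν z n := by
  rw [(hasDerivAt_logFactor χ ν hz hn).deriv, term_eq χ ν,
    show ν - 1 = ν - 2 + 1 by omega, pow_succ]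
  ring

lemma hasSum_term (hν : 1 < ν) {z : ℂ} (hz : 0 < z.im) :
    HasSum (fun n : ℕ ↦ Real.pi * term χ ν z (n + 1))
      (deriv (fun w ↦ ∑' n, logFactor χ ν (n + 1) w) z) := by
  simpa only [deriv_logFactor_eq χ ν hν hz (Nat.succ_ne_zero _)] using
    hasSum_deriv_logFactor χ ν hz

lemma summable_term (hν : 1 < ν) {z : ℂ} (hz : 0 < z.im) :
    Summable fun n : ℕ ↦ term χ ν z (n + 1) :=
  (summable_mul_left_iff (by exact_mod_cast Real.pi_ne_zero)).mp (hasSum_term χ ν hν hz).summable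

variable [NeZero k]

lemma product_eq {z : ℂ} (hz : 0 < z.im) :
    product χ ν z = cexp (-(2 * Real.pi * I * constA χ ν * z) +
      ∑' n, logFactor χ ν (n + 1) z) := by
  rw [product, tprod_factor χ ν hz, Complex.exp_add]

lemma hasDerivAt_product (hν : 1 < ν) {z : ℂ} (hz : 0 < z.im) :
    HasDerivAt (product χ ν) (product χ ν z * (-2 * Real.pi * I * constA χ ν +
      Real.pi * ∑' n : ℕ, term χ ν z (n + 1))) z := by
  have hU : {z : ℂ | 0 < z.im} ∈ 𝓝 z := (isOpen_lt_im 0).mem_nhds hz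
  have h1 := ((differentiableOn_tsum_logFactor χ ν).differentiableAt hU).hasDerivAt
  rw [← (hasSum_term χ ν hν hz).tsum_eq, tsum_mul_left] at h1
  have h2 := ((((hasDerivAt_id z).const_mul (2 * Real.pi * I * constA χ ν)).neg).add h1).cexp
  have h3 : product χ ν =ᶠ[𝓝 z] fun z ↦ cexp (-(2 * Real.pi * I * constA χ ν * z) +
      ∑' n, logFactor χ ν (n + 1) z) := by
    filter_upwards [hU] with w hw using product_eq χ ν hw
  refine (h2.congr_of_eventuallyEq h3).congr_deriv ?_
  rw [product_eq χ ν hz]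
  simp

lemma product_ne_zero {z : ℂ} (hz : 0 < z.im) : product χ ν z ≠ 0 := by
  rw [product_eq χ ν hz]
  exact Complex.exp_ne_zero _

lemma logDeriv_product (hν : 1 < ν) {z : ℂ} (hz : 0 < z.im) :
    logDeriv (product χ ν) z = -2 * Real.pi * I * constA χ ν +
      Real.pi * ∑' n : ℕ, term χ ν z (n + 1) := by
  rw [logDeriv_apply, (hasDerivAt_product χ ν hν hz).deriv,
    mul_div_cancel_left₀ _ (product_ne_zero χ ν hz)]

lemma differentiableOn_logDeriv_product (hν : 1 < ν) :
    DifferentiableOn ℂ (logDeriv (product χ ν)) {z | 0 < z.im} := by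
  have h : DifferentiableOn ℂ (product χ ν) {z | 0 < z.im} := fun z hz ↦
    (hasDerivAt_product χ ν hν hz).differentiableAt.differentiableWithinAt
  exact (h.deriv (isOpen_lt_im 0)).div h fun z hz ↦ product_ne_zero χ ν hz

end BorcherdsProduct

/-! ### The logarithmic derivative as an Eisenstein series. -/

namespace BorcherdsProduct

open Complex Filter Topology
open scoped ZMod

/-- Integers as pairs of a residue modulo `k` and a quotient. -/
noncomputable def zmodProdIntEquiv (k : ℕ) [NeZero k] : ZMod k × ℤ ≃ ℤ where
  toFun p := p.1.val + k * p.2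
  invFun n := (n, n / k)
  left_inv p := by
    have hk : (k : ℤ) ≠ 0 := by exact_mod_cast NeZero.ne k
    have h1 : (p.1.val : ℤ) / k = 0 :=
      Int.ediv_eq_zero_of_lt (by positivity) (by exact_mod_cast ZMod.val_lt p.1)
    refine Prod.ext (by simp) ?_
    change ((p.1.val : ℤ) + k * p.2) / k = p.2
    rw [Int.add_mul_ediv_left _ _ hk, h1, zero_add]
  right_inv n := by
    simp only [ZMod.val_intCast]
    exact Int.emod_add_mul_ediv n k

lemma tsum_int_eq_sum_zmod (k : ℕ) [NeZero k] {f : ℤ → ℂ} (hf : Summable f) :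
    ∑' n, f n = ∑ j : ZMod k, ∑' n : ℤ, f (j.val + k * n) := by
  have h : Summable fun c ↦ f (zmodProdIntEquiv k c) := (zmodProdIntEquiv k).summable_iff.mpr hf
  rw [← (zmodProdIntEquiv k).tsum_eq, Summable.tsum_prod h, tsum_fintype]
  rfl

lemma exists_norm_le {k : ℕ} [NeZero k] (ψ : ZMod k → ℂ) : ∃ B, 0 ≤ B ∧ ∀ j, ‖ψ j‖ ≤ B := by
  refine ⟨∑ j, ‖ψ j‖, by positivity, fun j ↦ ?_⟩
  exact Finset.single_le_sum (f := fun j ↦ ‖ψ j‖) (fun _ _ ↦ norm_nonneg _) (Finset.mem_univ j)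

variable {k : ℕ} [NeZero k]

lemma summable_mul_inv_linear_pow (ψ : ZMod k → ℂ) {ν : ℕ} (hν : 1 < ν) (w : ℂ) :
    Summable fun n : ℤ ↦ ψ n * ((w + n) ^ ν)⁻¹ := by
  obtain ⟨B, hB, h⟩ := exists_norm_le ψ
  have hs := (EisensteinSeries.linear_right_summable w 1 (k := ν) (by omega)).norm.mul_left B
  refine Summable.of_norm_bounded hs fun n ↦ ?_
  rw [norm_mul]
  simp only [Int.cast_one, one_mul, zpow_natCast]
  gcongr
  exact h _

lemma stdAddChar_val_mul (j : ZMod k) (r : ℕ) :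
    ZMod.stdAddChar (j * (r : ZMod k)) = cexp (2 * Real.pi * I * (j.val / k)) ^ r := by
  rw [← Complex.exp_nat_mul]
  have : j * (r : ZMod k) = ((j.val * r : ℤ) : ZMod k) := by simp
  rw [this, ZMod.stdAddChar_coe]
  congr 1
  push_cast
  ring

/-- Lipschitz' formula twisted by a function on `ZMod k`. -/
lemma tsum_mul_inv_linear_pow (ψ : ZMod k → ℂ) {ν : ℕ} (hν : 1 < ν) {τ : ℂ} (hτ : 0 < τ.im) :
    ∑' n : ℤ, ψ n * ((k * τ + n) ^ ν)⁻¹ =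
      ((k : ℂ) ^ ν)⁻¹ * ((-2 * Real.pi * I) ^ ν / (ν - 1).factorial) *
        ∑' r : ℕ, (r : ℂ) ^ (ν - 1) * nome τ ^ r * 𝓕 ψ (-r) := by
  have hk : (k : ℂ) ≠ 0 := by exact_mod_cast NeZero.ne k
  rw [tsum_int_eq_sum_zmod k (summable_mul_inv_linear_pow ψ hν _)]
  have him (j : ZMod k) : 0 < (τ + j.val / k).im := by
    have : ((j.val : ℂ) / k).im = 0 := by
      rw [← Complex.ofReal_natCast, ← Complex.ofReal_natCast, ← Complex.ofReal_div,
        Complex.ofReal_im]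
    rw [Complex.add_im, this]; linarith
  -- On the residue class of `j` a factor `k` comes out, leaving the classical Lipschitz sum at `τ +
  -- j / k`. The phases `e(j r / k)` then assemble into `𝓕 ψ (-r)`.
  have h1 (j : ZMod k) (n : ℤ) : ψ ((j.val + k * n : ℤ) : ZMod k) *
      ((k * τ + ((j.val + k * n : ℤ) : ℂ)) ^ ν)⁻¹ =
      ((k : ℂ) ^ ν)⁻¹ * ψ j * (1 / ((τ + j.val / k) + n) ^ ν) := by
    have : k * τ + ((j.val + k * n : ℤ) : ℂ) = k * ((τ + j.val / k) + n) := by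
      push_cast; field_simp; ring
    rw [this, mul_pow]
    simp
    ring
  have h2 (j : ZMod k) : ∑' n : ℤ, 1 / ((τ + j.val / k) + n) ^ ν =
      ((-2 * Real.pi * I) ^ ν / (ν - 1).factorial) *
        ∑' r : ℕ, (r : ℂ) ^ (ν - 1) * nome τ ^ r * ZMod.stdAddChar (j * (r : ZMod k)) := by
    have := EisensteinSeries.qExpansion_identity (k := ν - 1) (by omega) ⟨τ + j.val / k, him j⟩
    rw [show ν - 1 + 1 = ν by omega] at this
    simp only [] at this
    rw [this]
    congr 1
    refine tsum_congr fun r ↦ ?_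
    rw [mul_add, Complex.exp_add, mul_pow, stdAddChar_val_mul, nome]
    ring
  have hs (j : ZMod k) : Summable fun r : ℕ ↦
      ψ j * ((r : ℂ) ^ (ν - 1) * nome τ ^ r * ZMod.stdAddChar (j * (r : ZMod k))) := by
    refine Summable.mul_left _ (Summable.of_norm_bounded
      (summable_norm_pow_mul_geometric_of_norm_lt_one (ν - 1) (norm_nome_lt_one hτ)) fun r ↦ ?_)
    rw [norm_mul, AddChar.norm_apply, mul_one]
  simp_rw [h1, tsum_mul_left, h2]
  calc _ = ((k : ℂ) ^ ν)⁻¹ * ((-2 * Real.pi * I) ^ ν / (ν - 1).factorial) *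
        ∑ j : ZMod k, ∑' r : ℕ, ψ j *
          ((r : ℂ) ^ (ν - 1) * nome τ ^ r * ZMod.stdAddChar (j * (r : ZMod k))) := by
        rw [Finset.mul_sum]
        refine Finset.sum_congr rfl fun j _ ↦ ?_
        rw [tsum_mul_left]
        ring
    _ = _ := by
        rw [← Summable.tsum_finsetSum fun j _ ↦ hs j]
        congr 1
        refine tsum_congr fun r ↦ ?_
        rw [ZMod.dft_apply, Finset.mul_sum]
        refine Finset.sum_congr rfl fun j _ ↦ ?_
        simp
        ring

variable (χ : DirichletCharacter ℂ k) (ν : ℕ)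

/-- The series `∑ χ(n) n ^ (ν - 1) q ^ n / (1 - q ^ n)`. -/
noncomputable def lambertSeries (z : ℂ) : ℂ :=
  ∑' n : ℕ+, χ (n : ℕ) * (n : ℂ) ^ (ν - 1) * (nome z ^ (n : ℕ) / (1 - nome z ^ (n : ℕ)))

lemma logDeriv_product_eq_lambertSeries (hν : 1 < ν) {z : ℂ} (hz : 0 < z.im) :
    logDeriv (product χ ν) z = -2 * Real.pi * I * (constA χ ν + lambertSeries χ ν z) := by
  rw [logDeriv_product χ ν hν hz, lambertSeries,
    tsum_pnat_eq_tsum_succ (f := fun n ↦ χ (n : ZMod k) * (n : ℂ) ^ (ν - 1) *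
      (nome z ^ n / (1 - nome z ^ n)))]
  simp_rw [term_eq]
  rw [tsum_mul_left]
  ring

/-- The double series `∑ ψ(n) (k m z + n) ^ (-ν)` over integers `m`, `n`, summed over `n` first. -/
noncomputable def latticeSum (ψ : ZMod k → ℂ) (ν : ℕ) (z : ℂ) : ℂ :=
  ∑' m : ℤ, ∑' n : ℤ, ψ n * ((k * (m * z) + n) ^ ν)⁻¹

/-- The constant relating `latticeSum` to the logarithmic derivative of `product`. -/
noncomputable def latticeConst (k ν : ℕ) : ℂ :=
  ((k : ℂ) ^ ν)⁻¹ * ((-2 * Real.pi * I) ^ ν / (ν - 1).factorial) * k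

lemma latticeConst_ne_zero (k ν : ℕ) [NeZero k] : latticeConst k ν ≠ 0 := by
  have hk : (k : ℂ) ≠ 0 := by exact_mod_cast NeZero.ne k
  have : (Real.pi : ℂ) ≠ 0 := by exact_mod_cast Real.pi_ne_zero
  have : ((ν - 1).factorial : ℂ) ≠ 0 := by exact_mod_cast (Nat.factorial_ne_zero _)
  simp [latticeConst, *]

lemma nome_natCast_mul (m : ℕ) (z : ℂ) : nome (m * z) = nome z ^ m := by
  rw [nome, nome, ← Complex.exp_nat_mul]
  ring_nf

variable {χ ν}

/-- The Fourier transform commutes with `x ↦ -x`, so it inherits the parity of `χ`. -/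
lemma dft_neg_apply (hχ : χ (-1) = (-1) ^ ν) (x : ZMod k) :
    𝓕 χ (-x) = (-1) ^ ν * 𝓕 χ x := by
  have h : (fun j ↦ χ (-j)) = ((-1 : ℂ) ^ ν) • (χ : ZMod k → ℂ) := by
    ext j
    rw [← neg_one_mul, map_mul, hχ]
    simp
  have := congrFun (ZMod.dft_comp_neg (χ : ZMod k → ℂ)) x
  rw [h, map_smul] at this
  simpa using this.symm

lemma tsum_dft_mul_inv_linear_pow_pnat (hν : 1 < ν) {z : ℂ} (hz : 0 < z.im) (m : ℕ+) :
    ∑' n : ℤ, 𝓕 χ n * ((k * ((m : ℤ) * z) + n) ^ ν)⁻¹ =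
      latticeConst k ν * ∑' r : ℕ+, χ (r : ℕ) * (r : ℂ) ^ (ν - 1) * nome z ^ (m * r : ℕ) := by
  have him : 0 < ((m : ℕ) * z : ℂ).im := by
    have : 0 < (m : ℕ) := m.pos
    simp [hz]
  have h := tsum_mul_inv_linear_pow (𝓕 χ) hν him
  push_cast at h ⊢
  rw [h, latticeConst, mul_assoc _ (k : ℂ), ← tsum_mul_left (a := (k : ℂ)),
    ← tsum_pnat_eq_tsum_of_eq_zero]
  · congr 1
    refine tsum_congr fun r ↦ ?_
    -- Fourier inversion, `𝓕 (𝓕 χ) (-r) = k χ(r)`, is the source of the last factor `k` in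
    -- `latticeConst`.
    rw [nome_natCast_mul, ZMod.dft_dft, ← pow_mul]
    simp
    ring
  · simp [show ν - 1 ≠ 0 by omega]

omit [NeZero k] in
lemma summable_lambert_prod {z : ℂ} (hz : 0 < z.im) : Summable fun c : ℕ+ × ℕ+ ↦
    χ (c.2 : ℕ) * (c.2 : ℂ) ^ (ν - 1) * nome z ^ (c.1 * c.2 : ℕ) := by
  have h := (summable_prod_mul_pow (ν - 1) (norm_nome_lt_one hz)).norm
  refine Summable.of_norm_bounded h fun c ↦ ?_
  rw [mul_assoc, norm_mul]
  exact mul_le_of_le_one_left (norm_nonneg _) (DirichletCharacter.norm_le_one χ _)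

lemma tsum_pow_mul {w : ℂ} (hw : ‖w‖ < 1) : ∑' m : ℕ+, w ^ (m : ℕ) = w / (1 - w) := by
  rw [tsum_pnat_eq_tsum_succ (f := fun n ↦ w ^ n)]
  simp_rw [pow_succ]
  rw [tsum_mul_right, tsum_geometric_of_norm_lt_one hw]
  ring

omit [NeZero k] in
-- Expand `q ^ r / (1 - q ^ r)` as a geometric series in `m` and interchange the sums.
lemma lambertSeries_eq {z : ℂ} (hz : 0 < z.im) : lambertSeries χ ν z =
    ∑' m : ℕ+, ∑' r : ℕ+, χ (r : ℕ) * (r : ℂ) ^ (ν - 1) * nome z ^ (m * r : ℕ) := by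
  rw [← Summable.tsum_comm (f := fun m r : ℕ+ ↦ χ (r : ℕ) * (r : ℂ) ^ (ν - 1) *
    nome z ^ (m * r : ℕ)) (summable_lambert_prod hz), lambertSeries]
  refine tsum_congr fun r ↦ ?_
  rw [tsum_mul_left, ← tsum_pow_mul (norm_nome_pow_lt_one hz r.ne_zero)]
  congr 1
  refine tsum_congr fun m ↦ ?_
  rw [← pow_mul, mul_comm (r : ℕ)]

lemma summable_of_even_of_pnat {f : ℤ → ℂ} (hf : f.Even) (h : Summable fun m : ℕ+ ↦ f m) :
    Summable f := by
  have h' : Summable fun m : ℕ ↦ f m := summable_pnat_iff_summable_nat (f := fun m : ℕ ↦ f m) |>.mp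
    (by simpa using h)
  refine Summable.of_nat_of_neg h' ?_
  simpa only [hf _] using h'

lemma neg_pow_eq_neg_one_pow_mul (x : ℂ) : (-x) ^ ν = (-1) ^ ν * x ^ ν := by
  rw [← mul_pow, neg_one_mul]

lemma neg_one_pow_mul_self_complex : ((-1 : ℂ) ^ ν)⁻¹ * (-1) ^ ν = 1 :=
  inv_mul_cancel₀ (by simp)

/-- Under `(m, n) ↦ (-m, -n)` the sign `(-1) ^ ν` from `𝓕 χ` cancels the one from the power. -/
lemma even_tsum_dft (hχ : χ (-1) = (-1) ^ ν) (z : ℂ) :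
    (fun m : ℤ ↦ ∑' n : ℤ, 𝓕 χ n * ((k * (m * z) + n) ^ ν)⁻¹).Even := by
  intro m
  beta_reduce
  rw [← (Equiv.neg ℤ).tsum_eq]
  refine tsum_congr fun n ↦ ?_
  have : (k * (((-m : ℤ) : ℂ) * z) + ((Equiv.neg ℤ n : ℤ) : ℂ)) = -(k * (m * z) + n) := by
    simp; ring
  rw [this, neg_pow_eq_neg_one_pow_mul, mul_inv]
  simp only [Equiv.neg_apply, Int.cast_neg, dft_neg_apply hχ]
  linear_combination (𝓕 χ n * ((k * (m * z) + n) ^ ν)⁻¹) * neg_one_pow_mul_self_complex (ν := ν)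

/-- The functional equation at `s = ν`. Its two terms, with coefficients `I ^ ν` and `(-I) ^ ν`, are
equal because of the parity of `χ`, and their sum cancels the `2` in `A`. -/
lemma constA_eq (hν : 1 < ν) (hχ : χ (-1) = (-1) ^ ν) :
    latticeConst k ν * constA χ ν = ZMod.LFunction (𝓕 χ) ν := by
  have hk : (k : ℂ) ≠ 0 := by exact_mod_cast NeZero.ne k
  have hπ : (Real.pi : ℂ) ≠ 0 := by exact_mod_cast Real.pi_ne_zero
  have hf : ((ν - 1).factorial : ℂ) ≠ 0 := by exact_mod_cast (Nat.factorial_ne_zero _)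
  have h := ZMod.LFunction_one_sub (χ : ZMod k → ℂ) (s := ν)
    (fun n ↦ by
      intro h
      have : ((ν + n : ℕ) : ℂ) = 0 := by push_cast; rw [h]; ring
      have : ν + n = 0 := by exact_mod_cast this
      omega)
    (Or.inr (by
      intro h
      have : ν = 1 := by exact_mod_cast h
      omega))
  have h1 : (𝓕 fun x ↦ χ (-x)) = ((-1 : ℂ) ^ ν) • 𝓕 χ := by
    ext x
    rw [ZMod.dft_comp_neg]
    exact dft_neg_apply hχ x
  have h2 : ZMod.LFunction (((-1 : ℂ) ^ ν) • 𝓕 χ) ν = (-1) ^ ν * ZMod.LFunction (𝓕 χ) ν := by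
    simp only [ZMod.LFunction, Pi.smul_apply, smul_eq_mul, Finset.mul_sum]
    exact Finset.sum_congr rfl fun j _ ↦ by ring
  have h3 : cexp (Real.pi * I * ν / 2) = I ^ ν := by
    rw [show (Real.pi * I * ν / 2 : ℂ) = ν * (Real.pi / 2 * I) by ring, Complex.exp_nat_mul,
      Complex.exp_pi_div_two_mul_I]
  have h4 : cexp (-Real.pi * I * ν / 2) = (-I) ^ ν := by
    rw [show (-Real.pi * I * ν / 2 : ℂ) = ν * (-(Real.pi / 2 * I)) by ring, Complex.exp_nat_mul,
      Complex.exp_neg, Complex.exp_pi_div_two_mul_I, Complex.inv_I]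
  have h5 : (-I) ^ ν * (-1) ^ ν = I ^ ν := by rw [← mul_pow]; simp
  have h6 : Complex.Gamma ν = (ν - 1).factorial := by
    rw [← Complex.Gamma_nat_eq_factorial]
    congr 1
    push_cast [Nat.cast_sub hν.le]
    ring
  have h7 : (k : ℂ) ^ ((ν : ℂ) - 1) = k ^ ν / k := by
    rw [Complex.cpow_sub _ _ hk]; simp
  have h8 : (2 * Real.pi : ℂ) ^ (-(ν : ℂ)) = ((2 * Real.pi : ℂ) ^ ν)⁻¹ := by
    rw [Complex.cpow_neg, Complex.cpow_natCast]
  have h9 : (-2 * Real.pi * I) ^ ν = (2 * Real.pi) ^ ν * (-I) ^ ν := by rw [← mul_pow]; ring_nf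
  have h10 : (-I) ^ ν * I ^ ν = 1 := by rw [← mul_pow]; simp
  rw [h1, h2, h3, h4, h6, h7, h8] at h
  rw [constA, DirichletCharacter.LFunction, h, latticeConst, h9]
  have h11 : (2 * Real.pi : ℂ) ^ ν ≠ 0 := pow_ne_zero _ (by simp [hπ])
  have h12 : (k : ℂ) ^ ν ≠ 0 := pow_ne_zero _ hk
  field_simp
  linear_combination ZMod.LFunction (𝓕 χ) ν * ((-I) ^ ν * h5 + 2 * h10)

lemma tsum_dft_mul_inv_pow (hν : 1 < ν) (hχ : χ (-1) = (-1) ^ ν) :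
    ∑' n : ℤ, 𝓕 χ n * ((n : ℂ) ^ ν)⁻¹ = 2 * ZMod.LFunction (𝓕 χ) ν := by
  have heven : (fun n : ℤ ↦ 𝓕 χ n * ((n : ℂ) ^ ν)⁻¹).Even := by
    intro n
    simp only [Int.cast_neg, dft_neg_apply hχ]
    rw [neg_pow_eq_neg_one_pow_mul (n : ℂ), mul_inv]
    linear_combination (𝓕 χ n * ((n : ℂ) ^ ν)⁻¹) * neg_one_pow_mul_self_complex (ν := ν)
  have hs : Summable fun n : ℤ ↦ 𝓕 χ n * ((n : ℂ) ^ ν)⁻¹ := by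
    simpa using summable_mul_inv_linear_pow (𝓕 χ) hν 0
  rw [tsum_int_eq_zero_add_two_mul_tsum_pnat heven hs,
    ZMod.LFunction_eq_LSeries _ (by simpa using hν), LSeries,
    ← tsum_pnat_eq_tsum_of_eq_zero (by simp)]
  -- The term `n = 0` drops out through the convention `0⁻¹ = 0`.
  simp only [Int.cast_zero, zero_pow (show ν ≠ 0 by omega), inv_zero, mul_zero, zero_add,
    nsmul_eq_mul, Nat.cast_ofNat]
  congr 1
  refine tsum_congr fun n ↦ ?_
  rw [LSeries.term_of_ne_zero n.ne_zero]
  simp [div_eq_mul_inv]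

lemma latticeSum_eq (hν : 1 < ν) (hχ : χ (-1) = (-1) ^ ν) {z : ℂ} (hz : 0 < z.im) :
    latticeSum (𝓕 χ) ν z = 2 * latticeConst k ν * (constA χ ν + lambertSeries χ ν z) := by
  have hs : Summable fun m : ℤ ↦ ∑' n : ℤ, 𝓕 χ n * ((k * (m * z) + n) ^ ν)⁻¹ := by
    refine summable_of_even_of_pnat (even_tsum_dft hχ z) ?_
    simp_rw [tsum_dft_mul_inv_linear_pow_pnat hν hz]
    exact (summable_lambert_prod hz).prod.mul_left _
  rw [latticeSum, tsum_int_eq_zero_add_two_mul_tsum_pnat (even_tsum_dft hχ z) hs]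
  simp_rw [tsum_dft_mul_inv_linear_pow_pnat hν hz]
  rw [tsum_mul_left, ← lambertSeries_eq hz]
  simp only [Int.cast_zero, zero_mul, mul_zero, zero_add, nsmul_eq_mul, Nat.cast_ofNat]
  rw [tsum_dft_mul_inv_pow hν hχ, ← constA_eq hν hχ]
  ring

lemma logDeriv_product_eq_latticeSum (hν : 1 < ν) (hχ : χ (-1) = (-1) ^ ν) {z : ℂ}
    (hz : 0 < z.im) : logDeriv (product χ ν) z =
      -Real.pi * I * (latticeConst k ν)⁻¹ * latticeSum (𝓕 χ) ν z := by
  have := latticeConst_ne_zero k ν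
  rw [logDeriv_product_eq_lambertSeries χ ν hν hz, latticeSum_eq hν hχ hz]
  field_simp

end BorcherdsProduct

/-! ### Transformation under `Γ₀(k)`. -/

namespace BorcherdsProduct

open Complex Filter Topology
open scoped ZMod

/-- Right multiplication of row vectors by an integral matrix of determinant one. -/
def intProdEquiv (a b c d : ℤ) (h : a * d - b * c = 1) : ℤ × ℤ ≃ ℤ × ℤ where
  toFun p := (p.1 * a + p.2 * c, p.1 * b + p.2 * d)
  invFun p := (p.1 * d - p.2 * c, -p.1 * b + p.2 * a)
  left_inv p := by
    ext
    · linear_combination p.1 * h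
    · linear_combination p.2 * h
  right_inv p := by
    ext
    · linear_combination p.1 * h
    · linear_combination p.2 * h

lemma linear_ne_zero {z : ℂ} (hz : 0 < z.im) {a b c d : ℤ} (h : a * d - b * c = 1) :
    (c * z + d : ℂ) ≠ 0 := by
  intro h0
  have him := congrArg Complex.im h0
  have hre := congrArg Complex.re h0
  simp at him hre
  rcases him with hc | hz0
  · simp [hc] at hre
    simp [hc, hre] at h
  · exact hz.ne' hz0

lemma linear_mul_mobius_add {z : ℂ} (hz : 0 < z.im) {a b c d : ℤ} (h : a * d - b * c = 1)
    (m n : ℂ) : m * ((a * z + b) / (c * z + d)) + n =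
      ((m * a + n * c) * z + (m * b + n * d)) / (c * z + d) := by
  have := linear_ne_zero hz h
  rw [eq_div_iff this, add_mul, mul_assoc, div_mul_cancel₀ _ this]
  ring

variable {k : ℕ} [NeZero k] {χ : DirichletCharacter ℂ k} {ν : ℕ}

/-- Substituting `j ↦ u⁻¹ j` in the Gauss sum needs no primitivity of `χ`. This produces the factor
`χ(d)` of the modular transformation. -/
lemma dft_eq_mul_dft_unit_mul (u : (ZMod k)ˣ) (x : ZMod k) : 𝓕 χ x = χ u * 𝓕 χ (u * x) := by
  have h := ZMod.dft_comp_unitMul (χ : ZMod k → ℂ) u (u * x)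
  simp only [map_mul, Units.inv_mul_cancel_left] at h
  have h2 := congrFun (ZMod.dft_const_mul (χ u) (χ : ZMod k → ℂ)) (u * x)
  rw [← h, h2]

/-- By Fourier inversion the sum is `k χ(0)`. It fails to vanish exactly for `k = 1`, whence the
exclusion of that level in weight two. -/
lemma sum_dft_eq_zero (hk : k ≠ 1) : ∑ j, 𝓕 χ j = 0 := by
  rw [← ZMod.dft_apply_zero, ZMod.dft_dft]
  simp [χ.map_zero' hk]

section AbsolutelyConvergent

lemma summable_latticeSum (ψ : ZMod k → ℂ) (hν : 3 ≤ ν) {z : ℂ} (hz : 0 < z.im) :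
    Summable fun p : ℤ × ℤ ↦ ψ p.2 * ((k * (p.1 * z) + p.2) ^ ν)⁻¹ := by
  obtain ⟨B, hB, h⟩ := exists_norm_le ψ
  have him : 0 < (k * z).im := by
    have : 0 < k := Nat.pos_of_neZero k
    simp [hz, this]
  have hs := (summable_prod_eisSummand hν ⟨k * z, him⟩).norm.mul_left B
  refine Summable.of_norm_bounded hs fun p ↦ ?_
  rw [norm_mul]
  have : EisensteinSeries.eisSummand ν ![p.1, p.2] ⟨k * z, him⟩ =
      ((k * (p.1 * z) + p.2) ^ ν)⁻¹ := by
    simp [EisensteinSeries.eisSummand, mul_left_comm]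
  rw [this]
  gcongr
  exact h _

lemma latticeSum_mobius_of_three_le (hν : 3 ≤ ν) {z : ℂ} (hz : 0 < z.im) {a b c d : ℤ}
    (h : a * d - b * (k * c) = 1) (u : (ZMod k)ˣ) (hu : (u : ZMod k) = d)
    (hz' : 0 < ((a * z + b) / ((k * c : ℤ) * z + d)).im) :
    latticeSum (𝓕 χ) ν ((a * z + b) / ((k * c : ℤ) * z + d)) =
      χ d * ((k * c : ℤ) * z + d) ^ ν * latticeSum (𝓕 χ) ν z := by
  have hJ := linear_ne_zero hz h
  rw [latticeSum, latticeSum, ← Summable.tsum_prod (summable_latticeSum _ hν hz'),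
    ← Summable.tsum_prod (summable_latticeSum _ hν hz), ← tsum_mul_left,
    -- The summation vectors are `(k m, n)`, so `(a, b; k c, d)` acts on `(m, n)` as `(a, k b; c,
    -- d)`. The new second entry is `d n` modulo `k`.
    ← (intProdEquiv a (k * b) c d (by linear_combination h)).tsum_eq fun p : ℤ × ℤ ↦
      χ d * ((k * c : ℤ) * z + d) ^ ν * (𝓕 χ p.2 * ((k * (p.1 * z) + p.2) ^ ν)⁻¹)]
  refine tsum_congr fun p ↦ ?_
  have h1 := linear_mul_mobius_add hz h (k * p.1) p.2
  rw [mul_assoc] at h1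
  rw [h1, div_pow, inv_div, dft_eq_mul_dft_unit_mul u, hu]
  have h2 : ((p.1 * (k * b) + p.2 * d : ℤ) : ZMod k) = d * p.2 := by
    push_cast
    simp [mul_comm]
  simp only [intProdEquiv, Equiv.coe_fn_mk, h2]
  rw [div_eq_mul_inv, show (k * p.1 * a + p.2 * (k * c : ℤ)) * z + (k * p.1 * b + p.2 * d) =
    k * ((p.1 * a + p.2 * c : ℤ) * z) + ((p.1 * (k * b) + p.2 * d : ℤ) : ℂ) by push_cast; ring]
  ring

end AbsolutelyConvergent

section WeightTwo

lemma linearIndependent_pair_one {z : ℂ} (hz : 0 < z.im) : LinearIndependent ℝ ![z, 1] := by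
  rw [LinearIndependent.pair_iff]
  intro s t hst
  have him := congrArg Complex.im hst
  have hre := congrArg Complex.re hst
  simp at him hre
  rcases him with rfl | h
  · simpa using hre
  · exact absurd h hz.ne'

/-- The period pair `(z, 1)`. -/
noncomputable def periodPair {z : ℂ} (hz : 0 < z.im) : PeriodPair :=
  ⟨z, 1, linearIndependent_pair_one hz⟩

/-- Lattice points are negated so that they occur as `w + ℓ`. With `0⁻¹ = 0` this also holds at the
poles, which matters for the division point `j = 0` below. -/
lemma hasSum_weierstrassP_prod {z : ℂ} (hz : 0 < z.im) (w : ℂ) :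
    HasSum (fun p : ℤ × ℤ ↦ ((w + (p.1 * z + p.2)) ^ 2)⁻¹ - ((p.1 * z + p.2) ^ 2)⁻¹)
      (PeriodPair.weierstrassP (periodPair hz) w) := by
  have h := (periodPair hz).hasSum_weierstrassP w
  rw [← (periodPair hz).latticeEquivProd.symm.toEquiv.hasSum_iff,
    ← (Equiv.neg (ℤ × ℤ)).hasSum_iff] at h
  have hp (p : ℤ × ℤ) : ((periodPair hz).latticeEquivProd.symm (-p) : ℂ) = -(p.1 * z + p.2) := by
    rw [PeriodPair.latticeEquiv_symm_apply]
    simp only [periodPair, Prod.fst_neg, Prod.snd_neg]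
    push_cast
    ring
  refine h.congr_fun fun p ↦ ?_
  change _ = 1 / (w - ((periodPair hz).latticeEquivProd.symm (-p) : ℂ)) ^ 2 -
    1 / ((periodPair hz).latticeEquivProd.symm (-p) : ℂ) ^ 2
  rw [hp, one_div, one_div, sub_neg_eq_add, neg_sq]

lemma weierstrassP_add_mul_add {z : ℂ} (hz : 0 < z.im) (w : ℂ) (m n : ℤ) :
    (periodPair hz).weierstrassP (w + (m * z + n)) = (periodPair hz).weierstrassP w := by
  have h : (m * z + n : ℂ) ∈ (periodPair hz).lattice :=
    PeriodPair.mem_lattice.mpr ⟨m, n, by simp [periodPair]⟩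
  exact (periodPair hz).weierstrassP_add_coe w ⟨_, h⟩

/-- Homogeneity of `℘`: the lattice of the transformed point is the lattice of `z` divided by `c z +
d`. -/
lemma weierstrassP_mobius {z : ℂ} (hz : 0 < z.im) {a b c d : ℤ} (h : a * d - b * c = 1)
    (hz' : 0 < ((a * z + b) / (c * z + d)).im) (w : ℂ) :
    (periodPair hz').weierstrassP w =
      (c * z + d) ^ 2 * (periodPair hz).weierstrassP ((c * z + d) * w) := by
  have hJ := linear_ne_zero hz h
  have h1 := (hasSum_weierstrassP_prod hz ((c * z + d) * w)).mul_left ((c * z + d) ^ 2)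
  rw [← (intProdEquiv a b c d h).hasSum_iff] at h1
  refine (hasSum_weierstrassP_prod hz' w).unique (h1.congr_fun fun p ↦ ?_)
  have h2 := linear_mul_mobius_add hz h p.1 p.2
  simp only [Function.comp_apply, intProdEquiv, Equiv.coe_fn_mk, h2]
  push_cast
  set A : ℂ := (p.1 * a + p.2 * c) * z + (p.1 * b + p.2 * d)
  rw [show w + A / (c * z + d) = ((c * z + d) * w + A) / (c * z + d) by field_simp,
    div_pow, div_pow, inv_div, inv_div, div_eq_mul_inv, div_eq_mul_inv]
  ring

/-- The correction `ℓ ^ (-2)` in `℘` does not depend on `j`, so `∑ ψ = 0` removes it. Grouped by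
residues modulo `k`, the double series therefore converges unconditionally. -/
lemma latticeSum_two_eq {ψ : ZMod k → ℂ} (hψ : ∑ j, ψ j = 0) {z : ℂ} (hz : 0 < z.im) :
    latticeSum ψ 2 z =
      ((k : ℂ) ^ 2)⁻¹ * ∑ j, ψ j * (periodPair hz).weierstrassP (j.val / k) := by
  have hk : (k : ℂ) ≠ 0 := by exact_mod_cast NeZero.ne k
  have h1 : HasSum (fun p : ℤ × ℤ ↦ ∑ j, ψ j * ((j.val / k + (p.1 * z + p.2)) ^ 2)⁻¹)
      (∑ j, ψ j * (periodPair hz).weierstrassP (j.val / k)) := by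
    refine (hasSum_sum fun j _ ↦
      (hasSum_weierstrassP_prod hz (j.val / k)).mul_left (ψ j)).congr_fun fun p ↦ ?_
    simp_rw [mul_sub]
    rw [Finset.sum_sub_distrib, ← Finset.sum_mul, hψ, zero_mul, sub_zero]
  rw [← h1.tsum_eq, Summable.tsum_prod h1.summable, latticeSum, ← tsum_mul_left]
  refine tsum_congr fun m ↦ ?_
  have hs : Summable fun n : ℤ ↦ ψ n * ((k * (m * z) + n) ^ 2)⁻¹ :=
    summable_mul_inv_linear_pow ψ one_lt_two _
  have h2 (j : ZMod k) (n : ℤ) : ψ ((j.val + k * n : ℤ) : ZMod k) *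
      ((k * (m * z) + ((j.val + k * n : ℤ) : ℂ)) ^ 2)⁻¹ =
      ((k : ℂ) ^ 2)⁻¹ * (ψ j * ((j.val / k + (m * z + n)) ^ 2)⁻¹) := by
    have : k * (m * z) + ((j.val + k * n : ℤ) : ℂ) = k * (j.val / k + (m * z + n)) := by
      push_cast; field_simp; ring
    rw [this, mul_pow, mul_inv]
    simp
    ring
  have hs2 (j : ZMod k) : Summable fun n : ℤ ↦ ψ j * ((j.val / k + (m * z + n)) ^ 2)⁻¹ := by
    have h3 : Summable fun n : ℤ ↦ ψ ((j.val + k * n : ℤ) : ZMod k) *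
        ((k * (m * z) + ((j.val + k * n : ℤ) : ℂ)) ^ 2)⁻¹ :=
      hs.comp_injective (i := fun n : ℤ ↦ (j.val + k * n : ℤ)) fun x y hxy ↦ by
        have : (k : ℤ) ≠ 0 := by exact_mod_cast NeZero.ne k
        exact mul_left_cancel₀ this (add_left_cancel hxy)
    simp_rw [h2] at h3
    exact (summable_mul_left_iff (by simp [hk])).mp h3
  rw [tsum_int_eq_sum_zmod k hs, Summable.tsum_finsetSum fun j _ ↦ hs2 j, Finset.mul_sum]
  refine Finset.sum_congr rfl fun j _ ↦ ?_
  simp_rw [h2, tsum_mul_left]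

lemma latticeSum_mobius_two (hk : k ≠ 1) {z : ℂ} (hz : 0 < z.im) {a b c d : ℤ}
    (h : a * d - b * (k * c) = 1) (u : (ZMod k)ˣ) (hu : (u : ZMod k) = d)
    (hz' : 0 < ((a * z + b) / ((k * c : ℤ) * z + d)).im) :
    latticeSum (𝓕 χ) 2 ((a * z + b) / ((k * c : ℤ) * z + d)) =
      χ d * ((k * c : ℤ) * z + d) ^ 2 * latticeSum (𝓕 χ) 2 z := by
  have hk0 : (k : ℂ) ≠ 0 := by exact_mod_cast NeZero.ne k
  rw [latticeSum_two_eq (sum_dft_eq_zero hk) hz', latticeSum_two_eq (sum_dft_eq_zero hk) hz,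
    ← Equiv.sum_comp u.mulLeft fun j ↦ 𝓕 χ j * (periodPair hz).weierstrassP (j.val / k),
    mul_left_comm, Finset.mul_sum (a := χ d * _)]
  congr 1
  refine Finset.sum_congr rfl fun j _ ↦ ?_
  rw [weierstrassP_mobius hz h hz', dft_eq_mul_dft_unit_mul u j, Units.mulLeft_apply, ← hu]
  -- Modulo the lattice, `(k c z + d) j / k` is the division point of `d j`, because `c j z` is a
  -- period.
  have h1 : ∃ t : ℤ, d * j.val = ((u : ZMod k) * j).val + k * t := by
    have : ((d * j.val - ((u : ZMod k) * j).val : ℤ) : ZMod k) = 0 := by simp [hu]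
    obtain ⟨t, ht⟩ := (ZMod.intCast_zmod_eq_zero_iff_dvd _ k).mp this
    exact ⟨t, by linear_combination ht⟩
  obtain ⟨t, ht⟩ := h1
  have ht' : (d * j.val : ℂ) = ((u : ZMod k) * j).val + k * t := by exact_mod_cast ht
  have h2 : ((k * c : ℤ) * z + d) * (j.val / k : ℂ) =
      ((u : ZMod k) * j).val / k + ((c * j.val : ℤ) * z + t) := by
    push_cast
    field_simp
    linear_combination ht'
  rw [h2, weierstrassP_add_mul_add]
  ring

end WeightTwo

lemma latticeSum_mobius (hν : 1 < ν) (hk : ¬ (k = 1 ∧ ν = 2)) {z : ℂ} (hz : 0 < z.im)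
    {a b c d : ℤ} (h : a * d - b * (k * c) = 1)
    (hz' : 0 < ((a * z + b) / ((k * c : ℤ) * z + d)).im) :
    latticeSum (𝓕 χ) ν ((a * z + b) / ((k * c : ℤ) * z + d)) =
      χ d * ((k * c : ℤ) * z + d) ^ ν * latticeSum (𝓕 χ) ν z := by
  have had : (d : ZMod k) * a = 1 := by
    have := congrArg (Int.cast : ℤ → ZMod k) h
    push_cast at this
    simpa [mul_comm] using this
  let u : (ZMod k)ˣ := Units.mkOfMulEqOne _ _ had
  rcases (show 3 ≤ ν ∨ ν = 2 by omega) with h3 | rfl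
  · exact latticeSum_mobius_of_three_le h3 hz h u rfl hz'
  · exact latticeSum_mobius_two (fun h1 ↦ hk ⟨h1, rfl⟩) hz h u rfl hz'

/-- The logarithmic derivative of `product` as a function on the upper half plane. -/
noncomputable def logDerivProduct (χ : DirichletCharacter ℂ k) (ν : ℕ) (z : ℍ) : ℂ :=
  logDeriv (product χ ν) (z : ℂ)

lemma logDerivProduct_slash (hν : 1 < ν) (hχ : χ (-1) = (-1) ^ ν) (hk : ¬ (k = 1 ∧ ν = 2))
    {γ : SL(2, ℤ)} (hγ : γ ∈ CongruenceSubgroup.Gamma0 k) :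
    logDerivProduct χ ν ∣[(ν : ℤ)] γ = χ ((γ 1 1 : ℤ) : ZMod k) • logDerivProduct χ ν := by
  obtain ⟨c, hc⟩ := (ZMod.intCast_zmod_eq_zero_iff_dvd _ k).mp (CongruenceSubgroup.Gamma0_mem.mp hγ)
  have hdet : γ 0 0 * γ 1 1 - γ 0 1 * (k * c) = 1 := by
    rw [← hc, ← Matrix.det_fin_two]
    exact γ.det_coe
  ext z
  have hcoe : ((γ • z : ℍ) : ℂ) =
      ((γ 0 0 : ℤ) * z + (γ 0 1 : ℤ)) / ((k * c : ℤ) * z + (γ 1 1 : ℤ)) := by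
    rw [UpperHalfPlane.coe_specialLinearGroup_apply, hc]
    simp
  have hdenom : UpperHalfPlane.denom γ z = (k * c : ℤ) * z + (γ 1 1 : ℤ) := by
    rw [← hc]
    simp [UpperHalfPlane.denom]
  have hz := z.im_pos
  have hz' := (γ • z).im_pos
  have h := latticeSum_mobius (χ := χ) hν hk (z := z) hz hdet (by rw [← hcoe]; exact hz')
  have hJ := linear_ne_zero (z := z) hz hdet
  rw [ModularForm.SL_slash_apply, Pi.smul_apply, smul_eq_mul, logDerivProduct, logDerivProduct,
    logDeriv_product_eq_latticeSum hν hχ hz', logDeriv_product_eq_latticeSum hν hχ hz, hcoe, h,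
    hdenom, zpow_neg, zpow_natCast]
  have hJ' := pow_ne_zero ν hJ
  rw [← div_eq_mul_inv, div_eq_iff hJ']
  ring

end BorcherdsProduct

/-! ### Boundedness of periodic functions at infinity. -/

section PeriodicGrowth

open UpperHalfPlane Filter Topology Function Complex

/-- A periodic holomorphic function on the upper half plane that is `o(1 / q)` is bounded
at infinity. -/
lemma isBoundedAtImInfty_of_isLittleO {f : ℍ → ℂ} {h : ℝ} (hh : 0 < h)
    (hper : Periodic (f ∘ ofComplex) h) (hf : MDiff f)
    (ho : f =o[atImInfty] fun z ↦ Real.exp (2 * Real.pi * z.im / h)) :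
    IsBoundedAtImInfty f := by
  set F := UpperHalfPlane.cuspFunction h f with hF
  have hdiff : ∀ᶠ q in 𝓝[≠] (0 : ℂ), DifferentiableAt ℂ F q :=
    Periodic.eventually_differentiableAt_cuspFunction_nhds_ne_zero hh hper
      (eventually_of_mem (preimage_mem_comap (Ioi_mem_atTop 0))
        (fun z hz ↦ UpperHalfPlane.mdifferentiableAt_iff.mp (hf ⟨z, hz⟩)))
  have hq : ∀ᶠ q in 𝓝[≠] (0 : ℂ), ‖q‖ < 1 ∧ q ≠ 0 := by
    filter_upwards [mem_nhdsWithin_of_mem_nhds (Metric.ball_mem_nhds (0 : ℂ) one_pos),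
      self_mem_nhdsWithin] with q h1 h2 using ⟨by simpa using h1, h2⟩
  have ho1 : F =o[𝓝[≠] 0] fun q ↦ (q - 0)⁻¹ := by
    have h1 := (ho.comp_tendsto tendsto_comap_im_ofComplex).comp_tendsto
      (Periodic.invQParam_tendsto hh)
    have h2 : F =ᶠ[𝓝[≠] 0] (f ∘ ofComplex) ∘ Periodic.invQParam h := by
      filter_upwards [hq] with q hq
      exact Periodic.cuspFunction_eq_of_nonzero h _ hq.2
    refine (h1.congr' h2.symm .rfl).trans_isBigO (Asymptotics.IsBigO.of_bound 1 ?_)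
    filter_upwards [hq] with q hq
    have him := Periodic.im_invQParam_pos_of_norm_lt_one hh hq.1 hq.2
    have hqpos : 0 < ‖q‖ := norm_pos_iff.mpr hq.2
    have h3 : 2 * Real.pi * (Periodic.invQParam h q).im / h = -Real.log ‖q‖ := by
      rw [Periodic.im_invQParam]
      have := Real.pi_pos
      field_simp
    simp only [comp_apply, ofComplex_apply_of_im_pos him]
    rw [show (⟨Periodic.invQParam h q, him⟩ : ℍ).im = (Periodic.invQParam h q).im from rfl, h3,
      Real.exp_neg, Real.exp_log hqpos]
    simp
  -- The form demanded by the removable singularity theorem; the constant `F 0` is harmless since `1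
  -- / q` is unbounded.
  have ho2 : (fun q ↦ F q - F 0) =o[𝓝[≠] 0] fun q ↦ (q - 0)⁻¹ := by
    refine ho1.sub ?_
    rw [Asymptotics.isLittleO_const_left]
    right
    simpa only [sub_zero, comp_def] using tendsto_norm_inv_nhdsNE_zero_atTop (α := ℂ)
  have hlim := tendsto_limUnder_of_differentiable_on_punctured_nhds_of_isLittleO hdiff ho2
  have hlim2 : Tendsto f atImInfty (𝓝 (limUnder (𝓝[≠] 0) F)) := by
    have := hlim.comp ((Periodic.qParam_tendsto hh).comp tendsto_coe_atImInfty)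
    refine this.congr fun τ ↦ ?_
    exact eq_cuspFunction τ hh.ne' hper
  exact hlim2.isBigO_one ℝ

end PeriodicGrowth

/-! ### Moderate growth and the slash action. -/

section SlashGrowth

open UpperHalfPlane Filter Topology Function Complex

lemma denom_SL_eq (γ : SL(2, ℤ)) (z : ℍ) :
    denom γ z = (γ 1 0 : ℤ) * z + (γ 1 1 : ℤ) := by
  simp [denom]

lemma one_le_norm_denom (γ : SL(2, ℤ)) {z : ℍ} (hz : 1 ≤ z.im) : 1 ≤ ‖denom γ z‖ := by
  rw [denom_SL_eq]
  by_cases hc : γ 1 0 = 0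
  · have h := γ.det_coe
    rw [Matrix.det_fin_two, hc, mul_zero, sub_zero] at h
    have : |γ 1 1| = 1 :=
      Int.isUnit_iff_abs_eq.mp (IsUnit.of_mul_eq_one _ ((mul_comm _ _).trans h))
    rw [hc, Int.cast_zero, zero_mul, zero_add, Complex.norm_intCast]
    exact_mod_cast this.ge
  · have h1 : 1 ≤ |((γ 1 0 : ℤ) : ℝ)| := by exact_mod_cast Int.one_le_abs hc
    refine le_trans ?_ (Complex.abs_im_le_norm _)
    have : (((γ 1 0 : ℤ) : ℂ) * z + (γ 1 1 : ℤ)).im = (γ 1 0 : ℤ) * z.im := by simp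
    rw [this, abs_mul, abs_of_nonneg z.im_pos.le]
    nlinarith

lemma norm_denom_le (γ : SL(2, ℤ)) {z : ℍ} {A : ℝ} (hz : 1 ≤ z.im) (hA : |z.re| ≤ A) :
    ‖denom γ z‖ ≤ (|((γ 1 0 : ℤ) : ℝ)| * (A + 1) + |((γ 1 1 : ℤ) : ℝ)|) * z.im := by
  have hn : ‖(z : ℂ)‖ ≤ (A + 1) * z.im := by
    have h1 := Complex.norm_le_abs_re_add_abs_im (z : ℂ)
    rw [coe_re, coe_im, abs_of_nonneg z.im_pos.le] at h1
    have := abs_nonneg z.re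
    nlinarith
  rw [denom_SL_eq]
  refine (norm_add_le _ _).trans ?_
  rw [norm_mul, Complex.norm_intCast, Complex.norm_intCast, add_mul, mul_assoc]
  have := abs_nonneg ((γ 1 1 : ℤ) : ℝ)
  gcongr
  nlinarith

/-- Here `γ z` may approach the real line, but `1 / Im (γ z) = |c z + d| ^ 2 / Im z` is at most
linear in `Im z` on a strip, and the automorphy factor only helps since `|c z + d| ≥ 1`. -/
lemma norm_slash_le {f : ℍ → ℂ} {C : ℝ} {N : ℕ} (hf : ∀ z, ‖f z‖ ≤ C * (1 + 1 / z.im) ^ N)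
    (ν : ℕ) (γ : SL(2, ℤ)) (A : ℝ) :
    ∃ C', ∀ z : ℍ, 1 ≤ z.im → |z.re| ≤ A → ‖(f ∣[(ν : ℤ)] γ) z‖ ≤ C' * z.im ^ N := by
  set M := |((γ 1 0 : ℤ) : ℝ)| * (A + 1) + |((γ 1 1 : ℤ) : ℝ)| with hM
  have hC : 0 ≤ C := by
    have := (norm_nonneg _).trans (hf I)
    have h2 : 0 < (1 + 1 / UpperHalfPlane.I.im) ^ N := by simp
    exact nonneg_of_mul_nonneg_left this h2
  refine ⟨C * (1 + M ^ 2) ^ N, fun z hz hA ↦ ?_⟩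
  have hJ1 := one_le_norm_denom γ hz
  have hJ2 := norm_denom_le γ hz hA
  rw [← hM] at hJ2
  have hy := z.im_pos
  rw [ModularForm.SL_slash_apply, norm_mul, zpow_neg, zpow_natCast, norm_inv, norm_pow]
  have h1 : (‖denom γ z‖ ^ ν)⁻¹ ≤ 1 := inv_le_one_of_one_le₀ (one_le_pow₀ hJ1)
  have h2 : 1 + 1 / (γ • z).im ≤ (1 + M ^ 2) * z.im := by
    rw [ModularGroup.im_smul_eq_div_normSq, one_div_div, Complex.normSq_eq_norm_sq]
    have : ‖denom γ z‖ ^ 2 / z.im ≤ M ^ 2 * z.im := by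
      rw [div_le_iff₀ hy]
      calc ‖denom γ z‖ ^ 2 ≤ (M * z.im) ^ 2 := by gcongr
        _ = _ := by ring
    linarith
  have h3 : 0 ≤ 1 + 1 / (γ • z).im := by have := (γ • z).im_pos; positivity
  calc _ ≤ C * (1 + 1 / (γ • z).im) ^ N * 1 := by gcongr; exact hf _
    _ ≤ C * ((1 + M ^ 2) * z.im) ^ N * 1 := by gcongr
    _ = _ := by rw [mul_pow]; ring

lemma slash_T_zpow_apply (g : ℍ → ℂ) (ν n : ℤ) (z : ℍ) :
    (g ∣[ν] (ModularGroup.T ^ n)) z = g ((n : ℝ) +ᵥ z) := by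
  rw [ModularForm.SL_slash_apply, modular_T_zpow_smul]
  have : denom (ModularGroup.T ^ n : SL(2, ℤ)) z = 1 := by
    rw [denom_SL_eq, ModularGroup.coe_T_zpow]
    simp
  rw [this, one_zpow, mul_one]

/-- A holomorphic function of moderate growth whose slash by `γ` has a positive integral period
is bounded at the cusp `γ ∞`. -/
lemma isBoundedAtImInfty_slash {f : ℍ → ℂ} {C : ℝ} {N : ℕ} (hf : MDiff f)
    (hb : ∀ z, ‖f z‖ ≤ C * (1 + 1 / z.im) ^ N) (ν : ℕ) (γ : SL(2, ℤ)) {h : ℕ} (hh : 0 < h)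
    (hper : ∀ z : ℍ, (f ∣[(ν : ℤ)] γ) ((h : ℝ) +ᵥ z) = (f ∣[(ν : ℤ)] γ) z) :
    IsBoundedAtImInfty (f ∣[(ν : ℤ)] γ) := by
  set g := f ∣[(ν : ℤ)] γ with hg
  have hh' : (0 : ℝ) < h := by exact_mod_cast hh
  have hperC : Periodic (g ∘ ofComplex) ((h : ℝ) : ℂ) := by
    intro w
    -- Off the upper half plane `ofComplex` is constant, so periodicity is automatic there.
    by_cases! hw : 0 < w.im
    · have : 0 < (w + ((h : ℝ) : ℂ)).im := by simp [hw]
      simp only [comp_apply, ofComplex_apply_of_im_pos this, ofComplex_apply_of_im_pos hw]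
      rw [← hper ⟨w, hw⟩]
      congr 1
      ext
      simp [add_comm]
    · have : (w + ((h : ℝ) : ℂ)).im ≤ 0 := by simpa using hw
      simp only [comp_apply, ofComplex_apply_of_im_nonpos this, ofComplex_apply_of_im_nonpos hw]
  obtain ⟨C', hC'⟩ := norm_slash_le hb ν γ h
  rw [← hg] at hC'
  -- Periodicity moves `z` into the strip `|Re z| ≤ h` without changing `Im z`, removing the
  -- restriction on the real part.
  have hbound (z : ℍ) (hz : 1 ≤ z.im) : ‖g z‖ ≤ C' * z.im ^ N := by
    obtain ⟨n, hn⟩ := ModularGroup_T_zpow_mem_verticalStrip z hh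
    have h1 : (ModularGroup.T ^ (h * n : ℤ) • z).im = z.im := ModularGroup.im_T_zpow_smul z _
    have h2 : g (ModularGroup.T ^ (h * n : ℤ) • z) = g z := by
      have h3 := hperC.int_mul n z
      have him : 0 < ((z : ℂ) + n * ((h : ℝ) : ℂ)).im := by simp [z.im_pos]
      simp only [comp_apply, ofComplex_apply, ofComplex_apply_of_im_pos him] at h3
      rw [← h3]
      congr 1
      ext
      rw [ModularGroup.coe_T_zpow_smul_eq]
      simp [mul_comm]
    rw [← h2, ← h1]
    exact hC' _ (by rwa [h1]) hn.1
  refine isBoundedAtImInfty_of_isLittleO hh' hperC (hf.slash _ _) ?_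
  have hO : g =O[atImInfty] fun z ↦ z.im ^ N := by
    refine Asymptotics.IsBigO.of_bound C' ?_
    filter_upwards [atImInfty_mem _ |>.mpr ⟨1, fun z hz ↦ hz⟩] with z hz
    rw [Real.norm_of_nonneg (by have := z.im_pos; positivity)]
    exact hbound z hz
  refine hO.trans_isLittleO ?_
  have hlo := isLittleO_pow_exp_pos_mul_atTop N (b := 2 * Real.pi / h)
    (by have := Real.pi_pos; positivity)
  have := hlo.comp_tendsto (tendsto_comap (f := UpperHalfPlane.im) (x := atTop))
  refine this.congr (fun _ ↦ rfl) fun z ↦ ?_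
  simp only [comp_apply]
  congr 1
  ring

end SlashGrowth

/-! ### Moderate growth of the logarithmic derivative; conclusion. -/

namespace BorcherdsProduct

open Complex Filter Topology

lemma hasSum_ascFactorial_mul_geometric (j : ℕ) {r : ℝ} (hr0 : 0 ≤ r) (hr : r < 1) :
    HasSum (fun n : ℕ ↦ (((n + 1).ascFactorial j : ℕ) : ℝ) * r ^ n)
      (j.factorial * (1 / (1 - r) ^ (j + 1))) := by
  have h := (hasSum_choose_mul_geometric_of_norm_lt_one j (r := r)
    (by rwa [Real.norm_of_nonneg hr0])).mul_left (j.factorial : ℝ)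
  refine h.congr_fun fun n ↦ ?_
  rw [Nat.ascFactorial_eq_factorial_mul_choose]
  push_cast
  ring

/-- Replacing `(n + 1) ^ j` by the rising factorial gives a series with a closed form, of order `j +
1` in `1 / (1 - |q|)`. The denominators `|1 - q ^ (n + 1)| ≥ 1 - |q|` cost one more power. -/
lemma norm_tsum_lambert_le {a : ℕ → ℂ} (ha : ∀ n, ‖a n‖ ≤ 1) (j : ℕ) {q : ℂ} (hq : ‖q‖ < 1) :
    ‖∑' n : ℕ, a (n + 1) * ((n + 1 : ℕ) : ℂ) ^ j * (q ^ (n + 1) / (1 - q ^ (n + 1)))‖ ≤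
      j.factorial * (1 / (1 - ‖q‖)) ^ (j + 2) := by
  set r := ‖q‖ with hr
  have hr0 : 0 ≤ r := norm_nonneg q
  have hr1 : 0 < 1 - r := by linarith
  have h := (hasSum_ascFactorial_mul_geometric j hr0 hq).mul_right (1 / (1 - r))
  have hle := tsum_of_norm_bounded (f := fun n : ℕ ↦
    a (n + 1) * ((n + 1 : ℕ) : ℂ) ^ j * (q ^ (n + 1) / (1 - q ^ (n + 1)))) h fun n ↦ ?_
  · refine hle.trans (le_of_eq ?_)
    rw [one_div_pow, pow_succ _ (j + 1)]
    field_simp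
  · rw [norm_mul, norm_mul, norm_div, norm_pow, norm_pow, Complex.norm_natCast, ← hr]
    have h1 : ((n + 1 : ℕ) : ℝ) ^ j ≤ (((n + 1).ascFactorial j : ℕ) : ℝ) := by
      exact_mod_cast Nat.pow_succ_le_ascFactorial _ _
    have h2 : r ^ (n + 1) ≤ r ^ n := pow_le_pow_of_le_one hr0 hq.le (Nat.le_succ n)
    have h3 : 1 - r ≤ ‖1 - q ^ (n + 1)‖ := by
      have h4 := norm_sub_norm_le 1 (q ^ (n + 1))
      rw [norm_one, norm_pow, ← hr] at h4
      have h5 : r ^ (n + 1) ≤ r := pow_le_of_le_one hr0 hq.le n.succ_ne_zero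
      linarith
    calc _ ≤ 1 * (((n + 1).ascFactorial j : ℕ) : ℝ) * (r ^ n / (1 - r)) := by
          gcongr
          exact ha _
      _ = _ := by ring

/-- With `t = 2π Im z`, the inequality `1 + t ≤ exp t` gives `1 / (1 - exp (-t)) ≤ 1 + 1 / t`. -/
lemma one_div_one_sub_norm_nome_le {z : ℂ} (hz : 0 < z.im) :
    1 / (1 - ‖nome z‖) ≤ 1 + 1 / z.im := by
  have hπ := Real.pi_gt_three
  set t := 2 * Real.pi * z.im with ht
  have ht0 : 0 < t := by positivity
  have h1 : ‖nome z‖ ≤ 1 / (1 + t) := by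
    rw [norm_nome, Real.exp_neg, ← one_div]
    exact one_div_le_one_div_of_le (by linarith) (by linarith [Real.add_one_le_exp t])
  have h2 : t / (1 + t) ≤ 1 - ‖nome z‖ := by
    have : t / (1 + t) = 1 - 1 / (1 + t) := by field_simp; ring
    linarith
  calc 1 / (1 - ‖nome z‖) ≤ 1 / (t / (1 + t)) := one_div_le_one_div_of_le (by positivity) h2
    _ = 1 + 1 / t := by field_simp; ring
    _ ≤ 1 + 1 / z.im := by
      gcongr
      rw [ht]
      nlinarith

variable {k : ℕ} [NeZero k] {χ : DirichletCharacter ℂ k} {ν : ℕ}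

lemma exists_norm_logDerivProduct_le (hν : 1 < ν) :
    ∃ C, ∀ z : ℍ, ‖logDerivProduct χ ν z‖ ≤ C * (1 + 1 / z.im) ^ (ν + 1) := by
  refine ⟨2 * Real.pi * (‖constA χ ν‖ + (ν - 1).factorial), fun z ↦ ?_⟩
  have hz := z.im_pos
  have h1 : ‖lambertSeries χ ν z‖ ≤ (ν - 1).factorial * (1 + 1 / z.im) ^ (ν + 1) := by
    rw [lambertSeries, tsum_pnat_eq_tsum_succ (f := fun n ↦ χ (n : ZMod k) * (n : ℂ) ^ (ν - 1) *
      (nome z ^ n / (1 - nome z ^ n)))]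
    have hq : ‖nome z‖ < 1 := norm_nome_lt_one hz
    refine (norm_tsum_lambert_le (a := fun n ↦ χ (n : ZMod k))
      (fun n ↦ DirichletCharacter.norm_le_one χ _) (ν - 1) hq).trans ?_
    rw [show ν - 1 + 2 = ν + 1 by omega]
    have : 0 < 1 - ‖nome z‖ := by linarith
    gcongr
    exact one_div_one_sub_norm_nome_le hz
  have h2 : 1 ≤ (1 + 1 / z.im) ^ (ν + 1) := one_le_pow₀ (by simp [hz.le])
  rw [logDerivProduct, logDeriv_product_eq_lambertSeries χ ν hν hz, norm_mul]
  have h3 : ‖(-2 * Real.pi * I : ℂ)‖ = 2 * Real.pi := by simp [abs_of_pos Real.pi_pos]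
  rw [h3, mul_assoc (2 * Real.pi) (‖constA χ ν‖ + _)]
  have := Real.pi_pos
  gcongr
  refine (norm_add_le _ _).trans ?_
  rw [add_mul]
  gcongr
  exact le_mul_of_one_le_right (norm_nonneg _) h2

lemma mdifferentiable_logDerivProduct (hν : 1 < ν) : MDiff (logDerivProduct χ ν) := by
  rw [UpperHalfPlane.mdifferentiable_iff]
  refine (differentiableOn_logDeriv_product χ ν hν).congr fun z hz ↦ ?_
  simp [logDerivProduct, UpperHalfPlane.ofComplex_apply_of_im_pos hz]

lemma Gamma_le_Gamma0 (N : ℕ) : CongruenceSubgroup.Gamma N ≤ CongruenceSubgroup.Gamma0 N :=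
  fun _ h ↦ CongruenceSubgroup.Gamma0_mem.mpr (CongruenceSubgroup.Gamma_mem.mp h).2.2.1

/-- Since `Γ(k)` is normal, `γ T ^ k γ⁻¹` lies in it, and there `d ≡ 1` makes the character trivial.
Hence every slash has period `k`. -/
lemma logDerivProduct_slash_vadd (hν : 1 < ν) (hχ : χ (-1) = (-1) ^ ν)
    (hk : ¬ (k = 1 ∧ ν = 2)) (γ : SL(2, ℤ)) (z : ℍ) :
    (logDerivProduct χ ν ∣[(ν : ℤ)] γ) ((k : ℝ) +ᵥ z) = (logDerivProduct χ ν ∣[(ν : ℤ)] γ) z := by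
  have hT : ModularGroup.T ^ (k : ℤ) ∈ CongruenceSubgroup.Gamma k := by
    simpa using CongruenceSubgroup.ModularGroup_T_pow_mem_Gamma k k dvd_rfl
  have hconj : γ * ModularGroup.T ^ (k : ℤ) * γ⁻¹ ∈ CongruenceSubgroup.Gamma k :=
    (CongruenceSubgroup.Gamma_normal k).conj_mem _ hT γ
  have h1 := logDerivProduct_slash (χ := χ) hν hχ hk (Gamma_le_Gamma0 k hconj)
  rw [(CongruenceSubgroup.Gamma_mem.mp hconj).2.2.2, map_one, one_smul] at h1
  have h2 := slash_T_zpow_apply (logDerivProduct χ ν ∣[(ν : ℤ)] γ) ν k z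
  rw [← SlashAction.slash_mul,
    show γ * ModularGroup.T ^ (k : ℤ) = γ * ModularGroup.T ^ (k : ℤ) * γ⁻¹ * γ by group,
    SlashAction.slash_mul, h1] at h2
  exact_mod_cast h2.symm

lemma isModularFormWithChar_logDerivProduct (hν : 1 < ν) (hχ : χ (-1) = (-1) ^ ν)
    (hk : ¬ (k = 1 ∧ ν = 2)) {Γ : Subgroup SL(2, ℤ)} (hΓ : Γ ≤ CongruenceSubgroup.Gamma0 k) :
    IsModularFormWithChar Γ ν χ (logDerivProduct χ ν) where
  slash_eq γ hγ := logDerivProduct_slash hν hχ hk (hΓ hγ)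
  holo := mdifferentiable_logDerivProduct hν
  bdd_at_cusps c hc := by
    -- Every cusp of `Γ` is a cusp of `SL(2, ℤ)`, so it suffices to bound each slash by `γ ∈ SL(2,
    -- ℤ)` at infinity.
    have hc' : IsCusp c 𝒮ℒ := hc.mono (by
      rw [MonoidHom.range_eq_map]
      exact Subgroup.map_mono le_top)
    rw [OnePoint.isBoundedAt_iff_forall_SL2Z hc']
    intro γ _
    obtain ⟨C, hC⟩ := exists_norm_logDerivProduct_le (χ := χ) hν
    exact isBoundedAtImInfty_slash (mdifferentiable_logDerivProduct hν) hC ν γ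
      (Nat.pos_of_neZero k) (logDerivProduct_slash_vadd hν hχ hk γ)

end BorcherdsProduct

theorem theorem74 (k : ℕ) [NeZero k] (χ : DirichletCharacter ℂ k) (ν : ℕ) (hν : 1 < ν)
    (hχ : χ (-1) = (-1) ^ ν) :
    (∀ z : ℂ, 0 < z.im →
      Multipliable (fun n : ℕ => BorcherdsProduct.factor χ ν z (n + 1)) ∧
      BorcherdsProduct.product χ ν z ≠ 0 ∧
      DifferentiableAt ℂ (BorcherdsProduct.product χ ν) z ∧
      Summable (fun n : ℕ => BorcherdsProduct.term χ ν z (n + 1)) ∧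
      logDeriv (BorcherdsProduct.product χ ν) z =
        -2 * Real.pi * Complex.I * BorcherdsProduct.constA χ ν +
          Real.pi * ∑' n : ℕ, BorcherdsProduct.term χ ν z (n + 1)) ∧
    (¬ (k = 1 ∧ ν = 2) →
      IsModularFormWithChar (CongruenceSubgroup.Gamma0 k) ν χ
        (fun z : UpperHalfPlane => logDeriv (BorcherdsProduct.product χ ν) (z : ℂ)) ∧
      IsModularFormWithChar (CongruenceSubgroup.Gamma k) ν χ
        (fun z : UpperHalfPlane => logDeriv (BorcherdsProduct.product χ ν) (z : ℂ))) :=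
  ⟨fun _ hz ↦ ⟨BorcherdsProduct.multipliable_factor χ ν hz,
      BorcherdsProduct.product_ne_zero χ ν hz,
      (BorcherdsProduct.hasDerivAt_product χ ν hν hz).differentiableAt,
      BorcherdsProduct.summable_term χ ν hν hz, BorcherdsProduct.logDeriv_product χ ν hν hz⟩,
    fun hk ↦ ⟨BorcherdsProduct.isModularFormWithChar_logDerivProduct hν hχ hk le_rfl,
      BorcherdsProduct.isModularFormWithChar_logDerivProduct hν hχ hk
        (BorcherdsProduct.Gamma_le_Gamma0 k)⟩⟩
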